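/- For real $z,a,b$ with $a>-1$ let $$W(z,a,b)=\sum_{n=0}^{\infty}\frac{z^n}{n!\,\Gamma(an+b)}$$ be the Wright function (with $1/\Gamma=0$ at the poles $0,-1,-2,\dots$ of $\Gamma$), and for $0<\nu<1$ let $M_\nu(z)=W(-z,-\nu,1-\nu)$ be the Mainardi function. Let $0<\alpha<1$. Then the series defining $W(z,-\frac{\alpha}{2},1)$ and $W(z,-\frac{\alpha}{2},1-\frac{\alpha}{2})$ converge absolutely for every real $z$, and the function $$f(x)=1-W\left(-x,-\tfrac{\alpha}{2},1\right)$$ is positive and strictly increasing on $\mathbb{R}^+=(0,\infty)$. Moreover $f(0)=0$, and for every $x\ge 0$ the function $f$ is differentiable at $x$ with $f'(x)=M_{\alpha/2}(x)>0$. -/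

import Mathlib

/-- The `n`-th term `z ^ n / (n! * Γ(α n + β))` of the Wright series. Mathlib's `Real.Gamma`
takes the value `0` at the poles `0, -1, -2, …`, so that at these arguments the term is `0`, in
agreement with the usual convention that `1 / Γ` vanishes at the poles of `Γ`. -/
noncomputable def wrightTerm (z α β : ℝ) (n : ℕ) : ℝ :=
  z ^ n / ((n.factorial : ℝ) * Real.Gamma (α * (n : ℝ) + β))

/-- The Wright function `W(z, α, β) = ∑ z ^ n / (n! * Γ(α n + β))`. -/
noncomputable def wright (z α β : ℝ) : ℝ :=
  ∑' n : ℕ, wrightTerm z α β n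

/-- The Mainardi function `M_ν(z) = W(-z, -ν, 1 - ν)`. -/
noncomputable def mainardi (ν z : ℝ) : ℝ :=
  wright (-z) (-ν) (1 - ν)

open Filter Topology Finset

/-! Put ν = α/2. Termwise differentiation gives d/dy W(-y,-ν,β) = -W(-y,-ν,β-ν), so f' = M_ν and
everything rests on M_ν > 0.

Nonnegativity of W(-x,-ν,β) for β ≥ 0 comes from the power series (1-(1-X)^ν)^n (1-X)^(-β), whose
coefficients are nonnegative. Expand the n-th power, take the coefficient of X^(k+1) with n = ⌊x
k^ν⌋, and rescale: the j-th summand tends to (-x)^j / (j! Γ(β-νj)), and dominated convergence gives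
the limit (`wright_neg_nonneg`).

Nonnegativity at β-ν makes W(-y,-ν,β) antitone on y ≥ 0, so a zero there would persist to its right.
By analyticity W would vanish identically, against the value 1/Γ(β) at 0 (`wright_neg_pos`). -/

/-! ### Bounds for 1/Γ from Euler's limit -/

/-- The approximations of `1 / Γ` coming from the Euler limit formula converge at every real
argument, the poles of `Γ` included. -/
theorem tendsto_inv_gammaSeq (s : ℝ) :
    Tendsto (fun n => (Real.GammaSeq s n)⁻¹) atTop (𝓝 (Real.Gamma s)⁻¹) := by
  by_cases h : Real.Gamma s = 0
  · obtain ⟨m, rfl⟩ := (Real.Gamma_eq_zero_iff s).1 h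
    rw [h, inv_zero]
    refine tendsto_const_nhds.congr' ?_
    filter_upwards [eventually_ge_atTop m] with n hn
    have : ∏ j ∈ range (n + 1), (-(m : ℝ) + j) = 0 :=
      prod_eq_zero (mem_range.2 (Nat.lt_succ_of_le hn)) (by simp)
    simp [Real.GammaSeq, this]
  · exact (Real.GammaSeq_tendsto_Gamma s).inv₀ h

theorem inv_gammaSeq_neg (a : ℝ) (n : ℕ) :
    (Real.GammaSeq (-a) n)⁻¹ =
      (n : ℝ) ^ a * (∏ j ∈ range (n + 1), ((j : ℝ) - a)) / n.factorial := by
  rw [Real.GammaSeq, inv_div, Real.rpow_neg n.cast_nonneg]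
  simp only [neg_add_eq_sub]
  rw [div_mul_eq_div_div, div_inv_eq_mul, mul_comm]

/-- Bernoulli's inequality (1 - 1/(n+1))^a ≥ 1 - a/(n+1) bounds the ratio of consecutive terms by 1.
-/
theorem abs_inv_gammaSeq_neg_succ_le {a : ℝ} (ha : 1 ≤ a) {n : ℕ} (hn : ⌊a⌋₊ ≤ n) :
    |(Real.GammaSeq (-a) (n + 1))⁻¹| ≤ |(Real.GammaSeq (-a) n)⁻¹| := by
  have hfl : a < n + 1 := (Nat.lt_floor_add_one a).trans_le (by gcongr)
  have hn0 : (0 : ℝ) ≤ n := n.cast_nonneg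
  have hb := one_add_mul_self_le_rpow_one_add (s := -(1 / ((n : ℝ) + 1))) (p := a)
    (by rw [neg_le_neg_iff, div_le_one (by positivity)]; linarith) ha
  have h1 : 1 + -(1 / ((n : ℝ) + 1)) = n / (n + 1) := by field_simp; ring
  have h2 : 1 + a * -(1 / ((n : ℝ) + 1)) = (n + 1 - a) / (n + 1) := by field_simp; ring
  rw [h1, h2, Real.div_rpow hn0 (by positivity)] at hb
  rw [div_le_div_iff₀ (by positivity) (by positivity)] at hb
  rw [inv_gammaSeq_neg, inv_gammaSeq_neg, prod_range_succ _ (n + 1), Nat.factorial_succ]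
  push_cast
  rw [abs_div, abs_div, abs_mul, abs_mul _ ((n : ℝ) + 1 - a), abs_mul ((n : ℝ) ^ a),
    abs_of_pos (sub_pos.2 hfl),
    abs_of_nonneg (by positivity : (0 : ℝ) ≤ (n + 1 : ℝ) ^ a),
    abs_of_nonneg (by positivity : (0 : ℝ) ≤ (n : ℝ) ^ a),
    abs_of_nonneg (by positivity : (0 : ℝ) ≤ (n + 1 : ℝ) * n.factorial),
    abs_of_nonneg (by positivity : (0 : ℝ) ≤ (n.factorial : ℝ)),
    div_le_div_iff₀ (by positivity) (by positivity)]
  have := mul_le_mul_of_nonneg_right hb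
    (by positivity : 0 ≤ |∏ j ∈ range (n + 1), ((j : ℝ) - a)| * n.factorial)
  linarith

/-- Uniformity in n lets the same bound dominate the approximants and pass to 1/Γ. -/
theorem abs_inv_gammaSeq_neg_le {a : ℝ} (ha : 1 ≤ a) {n : ℕ} (hn : ⌊a⌋₊ ≤ n) :
    |(Real.GammaSeq (-a) n)⁻¹| ≤ (a + 1) * a ^ a := by
  have ha0 : 0 ≤ a := by linarith
  induction n, hn using Nat.le_induction with
  | succ n hn ih => exact (abs_inv_gammaSeq_neg_succ_le ha hn).trans ih
  | base =>
    set N := ⌊a⌋₊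
    have hN : (N : ℝ) ≤ a := Nat.floor_le ha0
    have hN' : a < N + 1 := Nat.lt_floor_add_one a
    have hprod : |∏ j ∈ range (N + 1), ((j : ℝ) - a)| ≤ (N + 1).factorial := by
      rw [abs_prod, ← Nat.descFactorial_self, Nat.descFactorial_eq_prod_range, Nat.cast_prod]
      refine prod_le_prod (fun _ _ => abs_nonneg _) fun j hj => ?_
      have hj' : j ≤ N := Nat.lt_succ_iff.1 (mem_range.1 hj)
      have hj'' : (j : ℝ) ≤ N := by exact_mod_cast hj'
      rw [Nat.cast_sub (by lia), abs_sub_comm, abs_of_nonneg (by linarith)]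
      push_cast
      linarith
    rw [inv_gammaSeq_neg, abs_div, abs_mul, Nat.abs_cast, abs_of_nonneg (by positivity),
      div_le_iff₀ (by positivity)]
    calc (N : ℝ) ^ a * |∏ j ∈ range (N + 1), ((j : ℝ) - a)|
        ≤ a ^ a * ((N + 1).factorial : ℝ) := by gcongr
      _ = (N + 1) * a ^ a * N.factorial := by rw [Nat.factorial_succ]; push_cast; ring
      _ ≤ (a + 1) * a ^ a * N.factorial := by gcongr

theorem abs_inv_gamma_neg_le {a : ℝ} (ha : 1 ≤ a) :
    |(Real.Gamma (-a))⁻¹| ≤ (a + 1) * a ^ a :=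
  le_of_tendsto (tendsto_inv_gammaSeq (-a)).abs <|
    (eventually_ge_atTop ⌊a⌋₊).mono fun _ => abs_inv_gammaSeq_neg_le ha

theorem exists_abs_inv_gammaSeq_le (s : ℝ) : ∃ C, ∀ n, |(Real.GammaSeq s n)⁻¹| ≤ C := by
  obtain ⟨C, hC⟩ := (tendsto_inv_gammaSeq s).abs.bddAbove_range
  exact ⟨C, fun n => hC ⟨n, rfl⟩⟩

/-! ### Convergence and regularity of the Wright series -/

theorem eventually_one_le_mul_sub {ν : ℝ} (hν : 0 < ν) (β : ℝ) :
    ∀ᶠ j : ℕ in atTop, 1 ≤ ν * j - β :=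
  (tendsto_atTop_add_const_right _ (-β)
    (tendsto_natCast_atTop_atTop.const_mul_atTop hν)).eventually_ge_atTop 1

/-- Since 1/j! ≤ (e/j)^j and ν < 1, the terms are eventually at most (2 e x j^(ν-1))^j, which beats
a geometric series. -/
theorem summable_wright_majorant {ν β : ℝ} (hν0 : 0 < ν) (hν1 : ν < 1) (hβ : 0 ≤ β) {x : ℝ}
    (hx : 0 ≤ x) :
    Summable fun j : ℕ => x ^ j / j.factorial * ((ν * j - β + 1) * (ν * j - β) ^ (ν * j - β)) := by
  have hlim : Tendsto (fun j : ℕ => x * Real.exp 1 * (j : ℝ) ^ (-(1 - ν))) atTop (𝓝 0) := by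
    simpa using ((tendsto_rpow_neg_atTop (sub_pos.2 hν1)).comp
      tendsto_natCast_atTop_atTop).const_mul (x * Real.exp 1)
  refine Summable.of_norm_bounded_eventually_nat (g := fun j : ℕ => (1 / 2 : ℝ) ^ j)
    summable_geometric_two ?_
  filter_upwards [eventually_one_le_mul_sub hν0 β, hlim.eventually_le_const (by norm_num : (0 : ℝ) < 1 / 4),
    eventually_ge_atTop 1] with j hj hsmall hj1
  have hj1' : (1 : ℝ) ≤ j := by exact_mod_cast hj1
  have hj0 : (0 : ℝ) < j := by linarith
  have ha : ν * j - β ≤ j := by nlinarith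
  rw [Real.norm_of_nonneg (by positivity)]
  have h1 : (ν * j - β + 1) ≤ 2 ^ j := by
    have : j + 1 ≤ 2 ^ j := Nat.lt_two_pow_self
    have : (j + 1 : ℝ) ≤ 2 ^ j := by exact_mod_cast this
    linarith
  have h2 : (ν * j - β) ^ (ν * j - β) ≤ ((j : ℝ) ^ ν) ^ j := by
    rw [← Real.rpow_mul_natCast hj0.le]
    exact (Real.rpow_le_rpow (by linarith) ha (by linarith)).trans
      (Real.rpow_le_rpow_of_exponent_le hj1' (by linarith))
  have h3 : (1 : ℝ) / j.factorial ≤ (Real.exp 1 / j) ^ j := by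
    have := Real.pow_div_factorial_le_exp (j : ℝ) hj0.le j
    rw [div_pow, ← Real.exp_nat_mul, mul_one, div_le_div_iff₀ (by positivity) (by positivity)]
    rw [div_le_iff₀ (by positivity)] at this
    linarith
  have h4 : Real.exp 1 / j * (j : ℝ) ^ ν = Real.exp 1 * (j : ℝ) ^ (-(1 - ν)) := by
    rw [neg_sub, Real.rpow_sub_one hj0.ne']
    ring
  calc x ^ j / j.factorial * ((ν * j - β + 1) * (ν * j - β) ^ (ν * j - β))
      = x ^ j * (1 / j.factorial) * ((ν * j - β + 1) * (ν * j - β) ^ (ν * j - β)) := by ring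
    _ ≤ x ^ j * (Real.exp 1 / j) ^ j * (2 ^ j * ((j : ℝ) ^ ν) ^ j) := by gcongr
    _ = (2 * (x * (Real.exp 1 / j * (j : ℝ) ^ ν))) ^ j := by simp only [mul_pow]; ring
    _ ≤ (1 / 2 : ℝ) ^ j := by
      rw [h4]
      gcongr
      linarith

theorem summable_wrightTerm {ν β : ℝ} (hν0 : 0 < ν) (hν1 : ν < 1) (hβ : 0 ≤ β) (z : ℝ) :
    Summable (wrightTerm z (-ν) β) := by
  refine Summable.of_norm_bounded_eventually_nat
    (summable_wright_majorant hν0 hν1 hβ (abs_nonneg z)) ?_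
  filter_upwards [eventually_one_le_mul_sub hν0 β] with j hj
  have h := abs_inv_gamma_neg_le hj
  rw [show -(ν * j - β) = -ν * j + β by ring] at h
  rw [wrightTerm, div_mul_eq_div_div, div_eq_mul_inv (z ^ j / _), norm_mul, norm_div, norm_pow,
    Real.norm_eq_abs, Real.norm_natCast, Real.norm_eq_abs]
  gcongr

theorem hasDerivAt_wright {ν β : ℝ} (hν0 : 0 < ν) (hν1 : ν < 1) (hβ : 0 ≤ β) (hνβ : ν ≤ β)
    (z : ℝ) : HasDerivAt (fun y => wright y (-ν) β) (wright z (-ν) (β - ν)) z := by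
  have hβν : 0 ≤ β - ν := sub_nonneg.2 hνβ
  set g' : ℕ → ℝ → ℝ := fun n y => n * y ^ (n - 1) / (n.factorial * Real.Gamma (-ν * n + β))
  have hsucc (n : ℕ) (y : ℝ) : g' (n + 1) y = wrightTerm y (-ν) (β - ν) n := by
    simp only [g', wrightTerm, Nat.factorial_succ, Nat.add_sub_cancel]
    push_cast
    rw [show -ν * ((n : ℝ) + 1) + β = -ν * n + (β - ν) by ring, mul_assoc,
      mul_div_mul_left _ _ (by positivity)]
  have hzero (y : ℝ) : g' 0 y = 0 := by simp [g']
  have hsum (y : ℝ) : Summable fun n => g' n y :=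
    (summable_nat_add_iff 1).1 <| by
      simpa only [hsucc] using summable_wrightTerm hν0 hν1 hβν y
  have hderiv := hasDerivAt_tsum_of_isPreconnected (𝕜 := ℝ) (g := fun n y => wrightTerm y (-ν) β n)
    (g' := g') (u := fun n => ‖g' n (|z| + 1)‖) (t := Metric.ball 0 (|z| + 1)) (y₀ := z) (y := z)
    (hsum _).norm Metric.isOpen_ball (convex_ball _ _).isPreconnected
    (fun n y _ => (hasDerivAt_pow n y).div_const _)
    (fun n y hy => by
      rw [mem_ball_zero_iff, Real.norm_eq_abs] at hy
      simp only [g', norm_div, norm_mul, norm_pow, Real.norm_eq_abs]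
      rw [abs_of_nonneg (by positivity : 0 ≤ |z| + 1)]
      gcongr)
    (by simp) (summable_wrightTerm hν0 hν1 hβ z) (by simp)
  have htsum : ∑' n, g' n z = wright z (-ν) (β - ν) := by
    rw [(hsum z).tsum_eq_zero_add, hzero, zero_add]
    simp only [hsucc, wright]
  rwa [htsum] at hderiv

theorem analyticOnNhd_wright {ν β : ℝ} (hν0 : 0 < ν) (hν1 : ν < 1) (hβ : 0 ≤ β) :
    AnalyticOnNhd ℝ (fun y => wright y (-ν) β) Set.univ := by
  set c : ℕ → ℝ := fun n => 1 / (n.factorial * Real.Gamma (-ν * n + β))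
  set p := FormalMultilinearSeries.ofScalars ℝ c
  have hr : p.radius = ⊤ := p.radius_eq_top_of_summable_norm fun r => by
    refine (summable_wrightTerm hν0 hν1 hβ r).norm.congr fun n => ?_
    simp [p, c, wrightTerm, div_eq_mul_inv]
    ring
  have hp := p.hasFPowerSeriesOnBall (by simp [hr])
  rw [hr] at hp
  have hsum : p.sum = fun y => wright y (-ν) β := by
    ext y
    rw [← FormalMultilinearSeries.ofScalarsSum, FormalMultilinearSeries.ofScalars_sum_eq]
    refine tsum_congr fun n => ?_
    simp only [c, wrightTerm, smul_eq_mul]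
    ring
  rw [← hsum]
  simpa using hp.analyticOnNhd

/-! ### Power series with nonnegative coefficients -/

/-- The power series of `(1 - X) ^ a`. -/
noncomputable def oneSubSeries (a : ℝ) : PowerSeries ℝ :=
  PowerSeries.rescale (-1) (PowerSeries.binomialSeries ℝ a)

theorem oneSubSeries_add (a b : ℝ) :
    oneSubSeries (a + b) = oneSubSeries a * oneSubSeries b := by
  simp [oneSubSeries]

theorem oneSubSeries_pow (a : ℝ) (n : ℕ) : oneSubSeries a ^ n = oneSubSeries (a * n) := by
  induction n with
  | zero => simp [oneSubSeries]
  | succ n ih => rw [pow_succ, ih, ← oneSubSeries_add]; push_cast; ring_nf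

theorem coeff_oneSubSeries (a : ℝ) (k : ℕ) :
    PowerSeries.coeff k (oneSubSeries a) = (∏ i ∈ range k, ((i : ℝ) - a)) / k.factorial := by
  rw [oneSubSeries, PowerSeries.coeff_rescale, PowerSeries.binomialSeries_coeff,
    Ring.choose_eq_smul, ← Polynomial.aeval_eq_smeval]
  have h : (-1) ^ k * Polynomial.aeval a (descPochhammer ℤ k) = ∏ i ∈ range k, ((i : ℝ) - a) := by
    induction k with
    | zero => simp
    | succ k ih =>
      rw [descPochhammer_succ_right, prod_range_succ, ← ih]
      simp
      ring
  rw [← h]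
  simp only [smul_eq_mul]
  ring

theorem coeff_oneSubSeries_nonneg {a : ℝ} (ha : a ≤ 0) (k : ℕ) :
    0 ≤ PowerSeries.coeff k (oneSubSeries a) := by
  rw [coeff_oneSubSeries]
  exact div_nonneg (prod_nonneg fun i _ => sub_nonneg.2 (ha.trans i.cast_nonneg))
    (Nat.cast_nonneg _)

theorem coeff_one_sub_oneSubSeries_nonneg {ν : ℝ} (hν0 : 0 ≤ ν) (hν1 : ν ≤ 1) (k : ℕ) :
    0 ≤ PowerSeries.coeff k (1 - oneSubSeries ν) := by
  rw [map_sub, coeff_oneSubSeries, PowerSeries.coeff_one]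
  cases k with
  | zero => simp
  | succ k =>
    -- Only the factor -ν at i = 0 is nonpositive, and the outer minus sign cancels it.
    rw [prod_range_succ']
    have : 0 ≤ ∏ i ∈ range k, (((i + 1 : ℕ) : ℝ) - ν) :=
      prod_nonneg fun i _ => by push_cast; linarith [i.cast_nonneg (α := ℝ)]
    simp only [Nat.add_eq_zero_iff, one_ne_zero, and_false, if_false, Nat.cast_zero, zero_sub,
      mul_neg, neg_div, neg_neg]
    positivity

theorem coeff_mul_nonneg {p q : PowerSeries ℝ} (hp : ∀ k, 0 ≤ PowerSeries.coeff k p)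
    (hq : ∀ k, 0 ≤ PowerSeries.coeff k q) (k : ℕ) : 0 ≤ PowerSeries.coeff k (p * q) := by
  rw [PowerSeries.coeff_mul]
  exact sum_nonneg fun _ _ => mul_nonneg (hp _) (hq _)

theorem coeff_pow_nonneg {p : PowerSeries ℝ} (hp : ∀ k, 0 ≤ PowerSeries.coeff k p)
    (n k : ℕ) : 0 ≤ PowerSeries.coeff k (p ^ n) := by
  induction n generalizing k with
  | zero => rw [pow_zero, PowerSeries.coeff_one]; split_ifs <;> norm_num
  | succ n ih => rw [pow_succ]; exact coeff_mul_nonneg ih hp k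

/-- The coefficients of `(1 - (1 - X) ^ ν) ^ n * (1 - X) ^ (-β)` are nonnegative. -/
theorem sum_choose_mul_coeff_oneSubSeries_nonneg {ν β : ℝ} (hν0 : 0 ≤ ν) (hν1 : ν ≤ 1)
    (hβ : 0 ≤ β) (n k : ℕ) :
    0 ≤ ∑ j ∈ range (n + 1),
      (-1) ^ j * n.choose j * PowerSeries.coeff k (oneSubSeries (ν * j - β)) := by
  have h := coeff_mul_nonneg
    (coeff_pow_nonneg (coeff_one_sub_oneSubSeries_nonneg hν0 hν1) n)
    (coeff_oneSubSeries_nonneg (neg_nonpos.2 hβ)) k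
  convert h using 1
  rw [sub_eq_neg_add, add_pow, sum_mul, map_sum]
  refine sum_congr rfl fun j _ => ?_
  rw [one_pow, mul_one, neg_pow (oneSubSeries ν), oneSubSeries_pow, sub_eq_add_neg, oneSubSeries_add,
    show ((-1 : PowerSeries ℝ) ^ j * oneSubSeries (ν * j) * (n.choose j : PowerSeries ℝ)
      * oneSubSeries (-β)) = PowerSeries.C ((-1 : ℝ) ^ j * n.choose j) *
        (oneSubSeries (ν * j) * oneSubSeries (-β)) by simp; ring, PowerSeries.coeff_C_mul]

/-! ### Passage to the limit -/

theorem inv_gammaSeq_neg_eq_coeff (a : ℝ) (k : ℕ) :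
    (Real.GammaSeq (-a) k)⁻¹ =
      (k + 1) * (k : ℝ) ^ a * PowerSeries.coeff (k + 1) (oneSubSeries a) := by
  rw [inv_gammaSeq_neg, coeff_oneSubSeries, Nat.factorial_succ]
  push_cast
  field_simp

theorem tendsto_choose_floor_mul_rpow {ν x : ℝ} (hν : 0 < ν) (hx : 0 < x) (j : ℕ) :
    Tendsto (fun k : ℕ => (⌊x * (k : ℝ) ^ ν⌋₊.choose j : ℝ) / (k : ℝ) ^ (ν * j)) atTop
      (𝓝 (x ^ j / j.factorial)) := by
  have hpow : Tendsto (fun k : ℕ => (k : ℝ) ^ ν) atTop atTop :=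
    (tendsto_rpow_atTop hν).comp tendsto_natCast_atTop_atTop
  have hfloor : Tendsto (fun k : ℕ => ⌊x * (k : ℝ) ^ ν⌋₊) atTop atTop :=
    tendsto_nat_floor_atTop.comp (hpow.const_mul_atTop hx)
  have heq := ((isEquivalent_choose j).comp_tendsto hfloor).div
    (Asymptotics.IsEquivalent.refl (u := fun k : ℕ => (k : ℝ) ^ (ν * j)))
  refine heq.symm.tendsto_nhds ?_
  have h := (((tendsto_nat_floor_mul_div_atTop hx.le).comp hpow).pow j).div_const (j.factorial : ℝ)
  refine h.congr fun k => ?_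
  simp only [Function.comp, Pi.div_apply]
  rw [Real.rpow_mul_natCast k.cast_nonneg, div_pow]
  ring

theorem wright_neg_nonneg {ν β : ℝ} (hν0 : 0 < ν) (hν1 : ν < 1) (hβ : 0 ≤ β) {x : ℝ}
    (hx : 0 < x) : 0 ≤ wright (-x) (-ν) β := by
  set N : ℕ → ℕ := fun k => ⌊x * (k : ℝ) ^ ν⌋₊
  set F : ℕ → ℕ → ℝ := fun k j => (-1) ^ j * ((N k).choose j / (k : ℝ) ^ (ν * j)) *
    (Real.GammaSeq (-(ν * j - β)) k)⁻¹
  choose C hC using fun j : ℕ => exists_abs_inv_gammaSeq_le (-(ν * j - β))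
  -- `C j` covers the finitely many j for which the uniform bound is unavailable.
  set B : ℕ → ℝ := fun j => x ^ j / j.factorial *
    if 1 ≤ ν * j - β then (ν * j - β + 1) * (ν * j - β) ^ (ν * j - β) else C j
  have hB : Summable B := by
    refine (summable_wright_majorant hν0 hν1 hβ hx.le).congr_atTop ?_
    filter_upwards [eventually_one_le_mul_sub hν0 β] with j hj
    simp [B, hj]
  have hlim : Tendsto (fun k => ∑' j, F k j) atTop (𝓝 (wright (-x) (-ν) β)) := by
    refine tendsto_tsum_of_dominated_convergence hB (fun j => ?_) ?_
    · have h := ((tendsto_choose_floor_mul_rpow hν0 hx j).const_mul ((-1) ^ j)).mul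
        (tendsto_inv_gammaSeq (-(ν * j - β)))
      convert h using 2
      rw [wrightTerm, neg_pow, show -(ν * j - β) = -ν * j + β by ring]
      ring
    -- For such k, j ≤ `N k` forces νj ≤ k, the range in which the uniform bound holds.
    · have hk : ∀ᶠ k : ℕ in atTop, ν * (x * (k : ℝ) ^ ν) ≤ k := by
        have := ((tendsto_rpow_neg_atTop (sub_pos.2 hν1)).comp
          tendsto_natCast_atTop_atTop).const_mul (ν * x)
        rw [mul_zero] at this
        filter_upwards [this.eventually_le_const one_pos, eventually_gt_atTop 0] with k hk hk0
        have hk0' : (0 : ℝ) < k := by exact_mod_cast hk0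
        have h4 : (k : ℝ) ^ ν = (k : ℝ) ^ (-(1 - ν)) * k := by
          rw [neg_sub, Real.rpow_sub_one hk0'.ne']; field_simp
        rw [h4]
        have := mul_le_mul_of_nonneg_right hk hk0'.le
        simp only [Function.comp] at this
        linarith
      filter_upwards [hk, eventually_gt_atTop 0] with k hk hk0 j
      have hk0' : (0 : ℝ) < k := by exact_mod_cast hk0
      rcases lt_or_ge (N k) j with hj | hj
      · have : 0 ≤ B j := by
          have := (abs_nonneg _).trans (hC j 0)
          simp only [B]
          split_ifs <;> positivity
        simpa [F, Nat.choose_eq_zero_of_lt hj] using this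
      · have hNk : (N k : ℝ) ≤ x * (k : ℝ) ^ ν := Nat.floor_le (by positivity)
        have hjN : (j : ℝ) ≤ N k := by exact_mod_cast hj
        have h1 : ((N k).choose j : ℝ) / (k : ℝ) ^ (ν * j) ≤ x ^ j / j.factorial := by
          rw [Real.rpow_mul_natCast hk0'.le, div_le_iff₀ (by positivity)]
          calc ((N k).choose j : ℝ) ≤ (N k : ℝ) ^ j / j.factorial := Nat.choose_le_pow_div j (N k)
            _ ≤ (x * (k : ℝ) ^ ν) ^ j / j.factorial := by gcongr
            _ = _ := by rw [mul_pow]; ring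
        have h2 : |(Real.GammaSeq (-(ν * j - β)) k)⁻¹| ≤
            if 1 ≤ ν * j - β then (ν * j - β + 1) * (ν * j - β) ^ (ν * j - β) else C j := by
          split_ifs with h
          · refine abs_inv_gammaSeq_neg_le h (Nat.floor_le_of_le ?_)
            have := mul_le_mul_of_nonneg_left (hjN.trans hNk) hν0.le
            linarith
          · exact hC j k
        simp only [F, B, norm_mul, norm_pow, norm_neg, norm_one, one_pow, one_mul]
        rw [Real.norm_of_nonneg (by positivity), Real.norm_eq_abs]
        gcongr
  refine ge_of_tendsto hlim ?_
  filter_upwards [eventually_gt_atTop 0] with k hk0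
  have hk0' : (0 : ℝ) < k := by exact_mod_cast hk0
  rw [tsum_eq_sum (s := range (N k + 1)) fun j hj => by
    have : N k < j := by simpa [Nat.lt_succ_iff] using hj
    simp [F, Nat.choose_eq_zero_of_lt this]]
  -- The scaling is free of j: the k^(νj) under the binomial cancels against k^(νj-β).
  have h := mul_nonneg (by positivity : 0 ≤ ((k : ℝ) + 1) * (k : ℝ) ^ (-β))
    (sum_choose_mul_coeff_oneSubSeries_nonneg hν0.le hν1.le hβ (N k) (k + 1))
  convert h using 1
  rw [mul_sum]
  refine sum_congr rfl fun j _ => ?_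
  simp only [F]
  rw [inv_gammaSeq_neg_eq_coeff, sub_eq_add_neg, Real.rpow_add hk0']
  field_simp

/-! ### Strict positivity and conclusion -/

theorem wright_zero (a b : ℝ) : wright 0 a b = (Real.Gamma b)⁻¹ := by
  rw [wright, tsum_eq_single 0 fun n hn => by simp [wrightTerm, hn]]
  simp [wrightTerm]

theorem wright_neg_pos {ν β : ℝ} (hν0 : 0 < ν) (hν1 : ν < 1) (hβ : 0 < β) (hνβ : ν ≤ β) {x : ℝ}
    (hx : 0 ≤ x) : 0 < wright (-x) (-ν) β := by
  have h0 : 0 < wright 0 (-ν) β := by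
    rw [wright_zero]; exact inv_pos.2 (Real.Gamma_pos_of_pos hβ)
  have hder (y : ℝ) : HasDerivAt (fun y => wright (-y) (-ν) β) (-wright (-y) (-ν) (β - ν)) y := by
    simpa [Function.comp_def] using (hasDerivAt_wright hν0 hν1 hβ.le hνβ (-y)).scomp y (hasDerivAt_neg y)
  have hanti : AntitoneOn (fun y => wright (-y) (-ν) β) (Set.Ici 0) := by
    refine antitoneOn_of_deriv_nonpos (convex_Ici 0)
      (fun y _ => (hder y).continuousAt.continuousWithinAt)
      (fun y _ => (hder y).differentiableAt.differentiableWithinAt) fun y hy => ?_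
    rw [interior_Ici] at hy
    rw [(hder y).deriv]
    exact neg_nonpos.2 (wright_neg_nonneg hν0 hν1 (sub_nonneg.2 hνβ) hy)
  by_contra hneg
  have hzero : ∀ y, x + 1 / 2 < y → wright (-y) (-ν) β = 0 := fun y hy =>
    le_antisymm ((hanti hx (Set.mem_Ici.2 (by linarith)) (by linarith)).trans (not_lt.1 hneg))
      (wright_neg_nonneg hν0 hν1 hβ.le (by linarith))
  have h := (analyticOnNhd_wright hν0 hν1 hβ.le).eqOn_zero_of_preconnected_of_eventuallyEq_zero
    isPreconnected_univ (Set.mem_univ (-(x + 1))) (by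
      filter_upwards [Iio_mem_nhds (by linarith : -(x + 1) < -(x + 1 / 2))] with y hy
      simpa using hzero (-y) (by linarith [Set.mem_Iio.1 hy]))
  exact h0.ne' (h (Set.mem_univ 0))

theorem mainTheorem7 (α : ℝ) (hα0 : 0 < α) (hα1 : α < 1) :
    -- both series converge (absolutely) at every real argument
    (∀ z : ℝ, Summable (wrightTerm z (-(α / 2)) 1)) ∧
    (∀ z : ℝ, Summable (wrightTerm z (-(α / 2)) (1 - α / 2))) ∧
    -- the function is positive and increasing on the positive half-line
    (∀ x : ℝ, 0 < x → 0 < 1 - wright (-x) (-(α / 2)) 1) ∧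
    StrictMonoOn (fun x : ℝ => 1 - wright (-x) (-(α / 2)) 1) (Set.Ioi 0) ∧
    -- its derivative is the Mainardi function, which is positive, and it vanishes at the origin
    (∀ x : ℝ, 0 ≤ x →
      HasDerivAt (fun y : ℝ => 1 - wright (-y) (-(α / 2)) 1) (mainardi (α / 2) x) x) ∧
    (∀ x : ℝ, 0 ≤ x → 0 < mainardi (α / 2) x) ∧
    1 - wright 0 (-(α / 2)) 1 = 0 := by
  have hν0 : 0 < α / 2 := by linarith
  have hν1 : α / 2 < 1 := by linarith
  have hzero : 1 - wright 0 (-(α / 2)) 1 = 0 := by simp [wright_zero]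
  have hder (x : ℝ) :
      HasDerivAt (fun y : ℝ => 1 - wright (-y) (-(α / 2)) 1) (mainardi (α / 2) x) x := by
    simpa [mainardi] using ((hasDerivAt_wright hν0 hν1 zero_le_one hν1.le (-x)).scomp x
      (hasDerivAt_neg x)).const_sub 1
  have hpos (x : ℝ) (hx : 0 ≤ x) : 0 < mainardi (α / 2) x :=
    -- With β = 1-ν, the condition ν ≤ β amounts to α ≤ 1.
    wright_neg_pos hν0 hν1 (by linarith) (by linarith) hx
  have hmono : StrictMonoOn (fun x : ℝ => 1 - wright (-x) (-(α / 2)) 1) (Set.Ici 0) := by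
    refine strictMonoOn_of_deriv_pos (convex_Ici 0)
      (fun y _ => (hder y).continuousAt.continuousWithinAt) fun y hy => ?_
    rw [interior_Ici] at hy
    rw [(hder y).deriv]
    exact hpos y (Set.mem_Ioi.1 hy).le
  refine ⟨summable_wrightTerm hν0 hν1 zero_le_one,
    summable_wrightTerm hν0 hν1 (by linarith), fun x hx => ?_,
    hmono.mono Set.Ioi_subset_Ici_self, fun x _ => hder x, hpos, hzero⟩
  have := hmono (Set.mem_Ici.2 le_rfl) (Set.mem_Ici.2 hx.le) hx
  simpa [hzero] using this
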